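/- Let $a<b$ be real numbers and let $h:[a,b]\longrightarrow[0,\infty)$ be a non-negative concave function with positive integral $\int_a^b h(t)\,\mathrm{d}t>0$ (equivalently, $h$ is not identically zero). Let $\alpha,\beta>0$, and write $$g_\alpha(h):=\frac{\int_a^b t\,h(t)^\alpha\,\mathrm{d}t}{\int_a^b h(t)^\alpha\,\mathrm{d}t}.$$ If $\beta\leq\alpha$ then $$\frac{\int_{g_\alpha(h)}^b h(t)^\beta\,\mathrm{d}t}{\int_a^b h(t)^\beta\,\mathrm{d}t}\geq\left(\frac{\beta+1}{\alpha+2}\right)^{\beta+1},$$ whereas if $\alpha\leq\beta$ then $$\frac{\int_{g_\alpha(h)}^b h(t)^\beta\,\mathrm{d}t}{\int_a^b h(t)^\beta\,\mathrm{d}t}\geq\left(\frac{\alpha+1}{\alpha+2}\right)^{\beta+1}.$$ -/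

import Mathlib

/-- The functional `α`-centroid of `h : [a, b] → [0, ∞)`,
`g_α(h) = (∫_a^b t h(t)^α dt) / (∫_a^b h(t)^α dt)`. -/
noncomputable def functionalCentroid (a b : ℝ) (h : ℝ → ℝ) (α : ℝ) : ℝ :=
  (∫ t in a..b, t * h t ^ α) / (∫ t in a..b, h t ^ α)

open MeasureTheory Set

/-! Write F_β(x) for the integral of h^β over [x, b] and φ_β = (F_β / F_β(a))^(1/(β+1)), so that
both claims are lower bounds for φ_β at the centroid g. As in Brunn–Minkowski, φ_β is concave
(`tailRoot_concaveOn`), so Jensen for the density proportional to h^α, whose mean is g, bounds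
φ_β(g) below by the h^α-average of φ_β.

If β ≤ α, that average is at least (β+1)/(α+2). The extremal behaviour is h proportional to 1 - φ_β,
where an exact derivative gives equality (`integral_tailRoot_weight_eq_zero`). In general h / (1 -
φ_β) is nonincreasing, and a single-sign-change comparison gives the inequality
(`le_integral_tailRoot_mul`).

If α ≤ β, the case of equal exponents gives φ_α(g) ≥ (α+1)/(α+2), and φ_α ≤ φ_β pointwise
(`tailRoot_mono`). The latter rests on a Berwald-type comparison of h with an affine function
(`tail_mul_rpow_le`). -/

theorem ConcaveOn.chord_le {a b : ℝ} {h : ℝ → ℝ} (hc : ConcaveOn ℝ (Icc a b) h) {u v w : ℝ}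
    (hu : a ≤ u) (huv : u ≤ v) (hvw : v ≤ w) (hw : w ≤ b) :
    (w - v) * h u + (v - u) * h w ≤ (w - u) * h v := by
  rcases eq_or_lt_of_le (huv.trans hvw) with e | huw
  · have h1 : v = u := by linarith
    have h2 : w = u := by linarith
    subst h1; subst h2; simp
  · have hd : 0 < w - u := by linarith
    obtain ⟨_, hc2⟩ := hc
    have key := hc2 (x := u) ⟨hu, by linarith⟩ (y := w) ⟨by linarith, hw⟩
      (a := (w - v) / (w - u)) (b := (v - u) / (w - u))
      (div_nonneg (by linarith) hd.le) (div_nonneg (by linarith) hd.le) (by field_simp; ring)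
    have e : ((w - v) / (w - u)) • u + ((v - u) / (w - u)) • w = v := by
      simp only [smul_eq_mul]; field_simp; ring
    rw [e] at key
    simp only [smul_eq_mul] at key
    have e2 : (w - v) * h u + (v - u) * h w
        = (w - u) * ((w - v) / (w - u) * h u + (v - u) / (w - u) * h w) := by
      field_simp
    rw [e2]
    exact mul_le_mul_of_nonneg_left key hd.le

theorem intervalIntegrable_of_continuousOn_Ioo_of_bound {a b C : ℝ} (hab : a ≤ b) {f : ℝ → ℝ}
    (hf : ContinuousOn f (Ioo a b)) (hC : ∀ t ∈ Ioo a b, |f t| ≤ C) :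
    IntervalIntegrable f volume a b := by
  rw [intervalIntegrable_iff_integrableOn_Ioo_of_le hab]
  refine IntegrableOn.of_bound (by simp) (hf.aestronglyMeasurable measurableSet_Ioo) C ?_
  filter_upwards [ae_restrict_mem measurableSet_Ioo] with t ht using hC t ht

theorem integral_line_rpow {x y H m β : ℝ} (hβ : 0 < β) (hm : 0 < m) :
    ∫ t in x..y, (H - m * (t - x)) ^ β
      = (H ^ (β + 1) - (H - m * (y - x)) ^ (β + 1)) / ((β + 1) * m) := by
  have hd : ∀ t ∈ uIcc x y, HasDerivAt
      (fun t => -(H - m * (t - x)) ^ (β + 1) / ((β + 1) * m)) ((H - m * (t - x)) ^ β) t := by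
    intro t _
    have h1 : HasDerivAt (fun t => H - m * (t - x)) (-m) t := by
      simpa using (((hasDerivAt_id t).sub_const x).const_mul m).const_sub H
    -- Since β + 1 ≥ 1, the power is differentiable even where the line vanishes, so no sign
    -- condition on it is needed.
    have h2 := ((h1.rpow_const (p := β + 1) (Or.inr (by linarith))).fun_neg).div_const ((β + 1) * m)
    have : β + 1 ≠ 0 := by positivity
    have e : -(-m * (β + 1) * (H - m * (t - x)) ^ (β + 1 - 1)) / ((β + 1) * m)
        = (H - m * (t - x)) ^ β := by
      rw [add_sub_cancel_right]
      field_simp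
    rwa [e] at h2
  have hcont : Continuous fun t => (H - m * (t - x)) ^ β :=
    Continuous.rpow_const (by fun_prop) fun _ => Or.inr hβ.le
  rw [intervalIntegral.integral_eq_sub_of_hasDerivAt hd (hcont.intervalIntegrable _ _)]
  simp only [sub_self, mul_zero, sub_zero]
  ring

/-- A concave function on `[a, b]` that is nonnegative there and positive in the interior. -/
structure IsPosConcave (a b : ℝ) (h : ℝ → ℝ) : Prop where
  lt : a < b
  nonneg : ∀ t ∈ Icc a b, 0 ≤ h t
  concave : ConcaveOn ℝ (Icc a b) h
  pos : ∀ t ∈ Ioo a b, 0 < h t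

theorem IsPosConcave.of_integral_pos {a b : ℝ} {h : ℝ → ℝ} (hab : a < b)
    (h0 : ∀ t ∈ Icc a b, 0 ≤ h t) (hc : ConcaveOn ℝ (Icc a b) h)
    (hi : 0 < ∫ t in a..b, h t) : IsPosConcave a b h := by
  refine ⟨hab, h0, hc, ?_⟩
  obtain ⟨s, hs, hs0⟩ : ∃ s ∈ Ioo a b, 0 < h s := by
    by_contra! hcon
    have : ∫ t in a..b, h t = 0 := by
      rw [intervalIntegral.integral_of_le hab.le, integral_Ioc_eq_integral_Ioo]
      refine setIntegral_eq_zero_of_forall_eq_zero fun t ht => ?_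
      exact le_antisymm (hcon t ht) (h0 t (Ioo_subset_Icc_self ht))
    linarith
  intro t ht
  have ha := h0 a ⟨le_rfl, hab.le⟩
  have hb := h0 b ⟨hab.le, le_rfl⟩
  obtain ⟨ht1, ht2⟩ := ht
  obtain ⟨hs1, hs2⟩ := hs
  rcases le_total t s with hts | hts
  · have := hc.chord_le le_rfl ht1.le hts hs2.le
    have h1 : 0 ≤ (s - t) * h a := mul_nonneg (by linarith) ha
    have h2 : 0 < (t - a) * h s := mul_pos (by linarith) hs0
    have h3 : 0 < (s - a) * h t := by linarith
    exact (mul_pos_iff_of_pos_left (by linarith)).1 h3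
  · have := hc.chord_le hs1.le hts ht2.le le_rfl
    have h1 : 0 ≤ (t - s) * h b := mul_nonneg (by linarith) hb
    have h2 : 0 < (b - t) * h s := mul_pos (by linarith) hs0
    have h3 : 0 < (b - s) * h t := by linarith
    exact (mul_pos_iff_of_pos_left (by linarith)).1 h3

/-! ### Boundedness and integrability of powers of h -/

namespace IsPosConcave

variable {a b : ℝ} {h : ℝ → ℝ} (H : IsPosConcave a b h)
include H

theorem continuousOn : ContinuousOn h (Ioo a b) := by
  have := H.concave.continuousOn_interior
  rwa [interior_Icc] at this

theorem exists_bound : ∃ C, 0 ≤ C ∧ ∀ t ∈ Icc a b, h t ≤ C := by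
  have hlt := H.lt
  -- Midpoint concavity at t and its reflection a + b - t gives this bound, since h is nonnegative
  -- at the reflection.
  refine ⟨2 * h ((a + b) / 2), by
    have := H.nonneg ((a + b) / 2) ⟨by linarith, by linarith⟩; linarith, fun t ht => ?_⟩
  have h1 := H.nonneg (a + b - t) ⟨by linarith [ht.2], by linarith [ht.1]⟩
  obtain ⟨_, hc2⟩ := H.concave
  have := hc2 (x := t) ht (y := a + b - t) ⟨by linarith [ht.2], by linarith [ht.1]⟩
    (a := 1 / 2) (b := 1 / 2) (by norm_num) (by norm_num) (by norm_num)
  simp only [smul_eq_mul] at this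
  rw [show 1 / 2 * t + 1 / 2 * (a + b - t) = (a + b) / 2 by ring] at this
  linarith

theorem continuousOn_rpow (β : ℝ) : ContinuousOn (fun t => h t ^ β) (Ioo a b) :=
  H.continuousOn.rpow_const fun t ht => Or.inl (H.pos t ht).ne'

theorem intervalIntegrable_mul {f : ℝ → ℝ} (hf : ContinuousOn f (Icc a b)) {β : ℝ} (hβ : 0 < β) :
    IntervalIntegrable (fun t => f t * h t ^ β) volume a b := by
  obtain ⟨C, hC0, hC⟩ := H.exists_bound
  obtain ⟨D, hD⟩ := isCompact_Icc.exists_bound_of_continuousOn hf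
  refine intervalIntegrable_of_continuousOn_Ioo_of_bound (C := D * C ^ β) H.lt.le
    ((hf.mono Ioo_subset_Icc_self).mul (H.continuousOn_rpow β)) fun t ht => ?_
  have ht' := Ioo_subset_Icc_self ht
  have h1 := Real.rpow_nonneg (H.nonneg t ht') β
  rw [abs_mul, abs_of_nonneg h1]
  exact mul_le_mul (hD t ht') (Real.rpow_le_rpow (H.nonneg t ht') (hC t ht') hβ.le) h1
    ((norm_nonneg _).trans (hD t ht'))

theorem intervalIntegrable_rpow {β : ℝ} (hβ : 0 < β) {x y : ℝ} (hx : a ≤ x) (hxy : x ≤ y)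
    (hy : y ≤ b) : IntervalIntegrable (fun t => h t ^ β) volume x y := by
  have := H.intervalIntegrable_mul (f := fun _ => 1) continuousOn_const hβ
  simp only [one_mul] at this
  refine this.mono_set ?_
  rw [uIcc_of_le hxy, uIcc_of_le H.lt.le]
  exact Icc_subset_Icc hx hy

theorem integral_pos {β : ℝ} (hβ : 0 < β) {x y : ℝ} (hx : a ≤ x) (hxy : x < y)
    (hy : y ≤ b) : 0 < ∫ t in x..y, h t ^ β :=
  intervalIntegral.intervalIntegral_pos_of_pos_on (H.intervalIntegrable_rpow hβ hx hxy.le hy)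
    (fun t ht => Real.rpow_pos_of_pos (H.pos t ⟨hx.trans_lt ht.1, ht.2.trans_le hy⟩) _) hxy

end IsPosConcave

/-- The integral of `h ^ β` over `[x, b]`. -/
noncomputable def tailIntegral (b : ℝ) (h : ℝ → ℝ) (β x : ℝ) : ℝ := ∫ t in x..b, h t ^ β

theorem tailIntegral_right (b : ℝ) (h : ℝ → ℝ) (β : ℝ) : tailIntegral b h β b = 0 := by
  simp [tailIntegral]

/-! ### Tail integrals -/

namespace IsPosConcave

variable {a b : ℝ} {h : ℝ → ℝ} (H : IsPosConcave a b h)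
include H

theorem tail_split {β : ℝ} (hβ : 0 < β) {x y : ℝ} (hx : a ≤ x) (hxy : x ≤ y) (hy : y ≤ b) :
    tailIntegral b h β x = (∫ t in x..y, h t ^ β) + tailIntegral b h β y :=
  (intervalIntegral.integral_add_adjacent_intervals (H.intervalIntegrable_rpow hβ hx hxy hy)
    (H.intervalIntegrable_rpow hβ (hx.trans hxy) hy le_rfl)).symm

theorem tail_pos {β : ℝ} (hβ : 0 < β) {x : ℝ} (hx : a ≤ x) (hxb : x < b) :
    0 < tailIntegral b h β x := H.integral_pos hβ hx hxb le_rfl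

theorem tail_nonneg {β : ℝ} (hβ : 0 < β) {x : ℝ} (hx : a ≤ x) (hxb : x ≤ b) :
    0 ≤ tailIntegral b h β x := by
  rcases hxb.eq_or_lt with rfl | hlt
  · rw [tailIntegral_right]
  · exact (H.tail_pos hβ hx hlt).le

theorem tail_strictAntiOn {β : ℝ} (hβ : 0 < β) :
    StrictAntiOn (tailIntegral b h β) (Icc a b) := by
  intro x hx y hy hxy
  rw [H.tail_split hβ hx.1 hxy.le hy.2]
  linarith [H.integral_pos hβ hx.1 hxy hy.2]

theorem tail_continuousOn {β : ℝ} (hβ : 0 < β) :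
    ContinuousOn (tailIntegral b h β) (Icc a b) := by
  have hi := H.intervalIntegrable_rpow hβ le_rfl H.lt.le le_rfl
  have := intervalIntegral.continuousOn_primitive_interval_left (f := fun t => h t ^ β)
    (μ := volume) (a := a) (b := b) (by
      rw [uIcc_of_le H.lt.le]
      exact (intervalIntegrable_iff_integrableOn_Icc_of_le H.lt.le).1 hi)
  rwa [uIcc_of_le H.lt.le] at this

theorem tail_hasDerivAt {β : ℝ} (hβ : 0 < β) {x : ℝ} (hx : x ∈ Ioo a b) :
    HasDerivAt (tailIntegral b h β) (-h x ^ β) x := by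
  have hc := H.continuousOn_rpow β
  refine intervalIntegral.integral_hasDerivAt_left
    (H.intervalIntegrable_rpow hβ hx.1.le hx.2.le le_rfl) ?_
    (hc.continuousAt (isOpen_Ioo.mem_nhds hx))
  exact hc.stronglyMeasurableAtFilter isOpen_Ioo x hx

/-- `h ^ (β + 1) / ∫_x^b h ^ β` is nondecreasing. -/
theorem rpow_mul_tail_le {β : ℝ} (hβ : 0 < β) {x y : ℝ} (hx : x ∈ Ioo a b) (hy : y ∈ Ioo a b)
    (hxy : x ≤ y) :
    h x ^ (β + 1) * tailIntegral b h β y ≤ h y ^ (β + 1) * tailIntegral b h β x := by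
  have hhx := H.pos x hx
  have hhy := H.pos y hy
  rcases le_or_gt (h x) (h y) with hle | hlt
  · exact mul_le_mul (Real.rpow_le_rpow hhx.le hle (by linarith))
      ((H.tail_strictAntiOn hβ).antitoneOn (Ioo_subset_Icc_self hx) (Ioo_subset_Icc_self hy) hxy)
      (H.tail_nonneg hβ hy.1.le hy.2.le) (Real.rpow_nonneg hhy.le _)
  have hxy' : x < y := lt_of_le_of_ne hxy (by rintro rfl; exact lt_irrefl _ hlt)
  -- When h drops from x to y, the secant of slope -m through both points lies below h on [x, y] and
  -- above h on [y, b]. Integrating its β-th power bounds the first piece below and the tail above.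
  obtain ⟨m, hm⟩ : ∃ m, m = (h x - h y) / (y - x) := ⟨_, rfl⟩
  have hd : 0 < y - x := by linarith
  have hm0 : 0 < m := hm ▸ div_pos (by linarith) hd
  have hmd : m * (y - x) = h x - h y := by rw [hm]; field_simp
  have hpm : 0 < (β + 1) * m := by positivity
  have hline : ∀ t ∈ Icc y b, h t ≤ h y - m * (t - y) := by
    intro t ht
    have := H.concave.chord_le hx.1.le hxy ht.1 ht.2
    have e : (y - x) * h t ≤ (y - x) * (h y - m * (t - y)) := by
      have : (y - x) * (h y - m * (t - y)) = (y - x) * h y - (h x - h y) * (t - y) := by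
        rw [← hmd]; ring
      rw [this]; nlinarith
    exact le_of_mul_le_mul_left e hd
  have hline' : ∀ t ∈ Icc x y, h x - m * (t - x) ≤ h t := by
    intro t ht
    have := H.concave.chord_le hx.1.le ht.1 ht.2 hy.2.le
    have e : (y - x) * (h x - m * (t - x)) ≤ (y - x) * h t := by
      have : (y - x) * (h x - m * (t - x)) = (y - x) * h x - (h x - h y) * (t - x) := by
        rw [← hmd]; ring
      rw [this]; nlinarith
    exact le_of_mul_le_mul_left e hd
  have hci : ∀ c z u v : ℝ, IntervalIntegrable (fun t => (c - m * (t - z)) ^ β) volume u v :=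
    fun c z u v => (Continuous.rpow_const (by fun_prop) fun _ => Or.inr hβ.le).intervalIntegrable _ _
  have hyb : 0 ≤ h y - m * (b - y) :=
    (H.nonneg b ⟨H.lt.le, le_rfl⟩).trans (hline b ⟨hy.2.le, le_rfl⟩)
  have h1 : tailIntegral b h β y ≤ h y ^ (β + 1) / ((β + 1) * m) := by
    have : tailIntegral b h β y ≤ ∫ t in y..b, (h y - m * (t - y)) ^ β :=
      intervalIntegral.integral_mono_on hy.2.le
        (H.intervalIntegrable_rpow hβ hy.1.le hy.2.le le_rfl) (hci _ _ _ _) fun t ht =>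
        Real.rpow_le_rpow (H.nonneg t ⟨hy.1.le.trans ht.1, ht.2⟩) (hline t ht) hβ.le
    refine this.trans ?_
    rw [integral_line_rpow hβ hm0]
    gcongr
    linarith [Real.rpow_nonneg hyb (β + 1)]
  have h2 : (h x ^ (β + 1) - h y ^ (β + 1)) / ((β + 1) * m) ≤ ∫ t in x..y, h t ^ β := by
    have e : h x - m * (y - x) = h y := by linarith
    have := integral_line_rpow (x := x) (y := y) (H := h x) hβ hm0
    rw [e] at this
    rw [← this]
    refine intervalIntegral.integral_mono_on hxy (hci _ _ _ _)
      (H.intervalIntegrable_rpow hβ hx.1.le hxy hy.2.le) fun t ht =>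
      Real.rpow_le_rpow ?_ (hline' t ht) hβ.le
    nlinarith [ht.2]
  rw [H.tail_split hβ hx.1.le hxy hy.2.le]
  rw [le_div_iff₀ hpm] at h1
  rw [div_le_iff₀ hpm] at h2
  have hA : h y ^ (β + 1) ≤ h x ^ (β + 1) := Real.rpow_le_rpow hhy.le hlt.le (by linarith)
  have hB : 0 ≤ h y ^ (β + 1) := Real.rpow_nonneg hhy.le _
  have h3 := mul_le_mul_of_nonneg_left h1 (sub_nonneg.2 hA)
  have h4 := mul_le_mul_of_nonneg_left h2 hB
  refine le_of_mul_le_mul_right ?_ hpm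
  nlinarith

end IsPosConcave

/-- The normalized tail integral of `h ^ β` raised to the power `1 / (β + 1)`. -/
noncomputable def tailRoot (a b : ℝ) (h : ℝ → ℝ) (β x : ℝ) : ℝ :=
  (tailIntegral b h β x / tailIntegral b h β a) ^ (1 / (β + 1))

theorem tailRoot_right (a b : ℝ) (h : ℝ → ℝ) {β : ℝ} (hβ : 0 < β) : tailRoot a b h β b = 0 := by
  rw [tailRoot, tailIntegral_right, zero_div, Real.zero_rpow (by positivity)]

/-! ### Concavity of the normalized tail root -/

namespace IsPosConcave

variable {a b : ℝ} {h : ℝ → ℝ} (H : IsPosConcave a b h)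
include H

theorem tailRatio_nonneg {β : ℝ} (hβ : 0 < β) {x : ℝ} (hx : x ∈ Icc a b) :
    0 ≤ tailIntegral b h β x / tailIntegral b h β a :=
  div_nonneg (H.tail_nonneg hβ hx.1 hx.2) (H.tail_pos hβ le_rfl H.lt).le

theorem tailRatio_pos {β : ℝ} (hβ : 0 < β) {x : ℝ} (hx : x ∈ Ioo a b) :
    0 < tailIntegral b h β x / tailIntegral b h β a :=
  div_pos (H.tail_pos hβ hx.1.le hx.2) (H.tail_pos hβ le_rfl H.lt)

theorem tailRoot_left {β : ℝ} (hβ : 0 < β) : tailRoot a b h β a = 1 := by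
  rw [tailRoot, div_self (H.tail_pos hβ le_rfl H.lt).ne', Real.one_rpow]

theorem tailRoot_rpow {β : ℝ} (hβ : 0 < β) {x : ℝ} (hx : x ∈ Icc a b) :
    tailRoot a b h β x ^ (β + 1) = tailIntegral b h β x / tailIntegral b h β a := by
  rw [tailRoot, ← Real.rpow_mul (H.tailRatio_nonneg hβ hx), one_div,
    inv_mul_cancel₀ (by positivity), Real.rpow_one]

theorem tailRoot_strictAntiOn {β : ℝ} (hβ : 0 < β) :
    StrictAntiOn (tailRoot a b h β) (Icc a b) := by
  intro x hx y hy hxy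
  exact Real.rpow_lt_rpow (H.tailRatio_nonneg hβ hy)
    (div_lt_div_of_pos_right (H.tail_strictAntiOn hβ hx hy hxy) (H.tail_pos hβ le_rfl H.lt))
    (by positivity)

theorem tailRoot_le_one {β : ℝ} (hβ : 0 < β) {x : ℝ} (hx : x ∈ Icc a b) :
    tailRoot a b h β x ≤ 1 := by
  rw [← H.tailRoot_left hβ]
  exact (H.tailRoot_strictAntiOn hβ).antitoneOn ⟨le_rfl, H.lt.le⟩ hx hx.1

theorem tailRoot_continuousOn {β : ℝ} (hβ : 0 < β) :
    ContinuousOn (tailRoot a b h β) (Icc a b) :=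
  ((H.tail_continuousOn hβ).div_const _).rpow_const fun _ _ => Or.inr (by positivity)

theorem tailRoot_hasDerivAt {β : ℝ} (hβ : 0 < β) {x : ℝ} (hx : x ∈ Ioo a b) :
    HasDerivAt (tailRoot a b h β)
      (-h x ^ β / tailIntegral b h β a * (1 / (β + 1)) *
        (tailIntegral b h β x / tailIntegral b h β a) ^ (1 / (β + 1) - 1)) x :=
  ((H.tail_hasDerivAt hβ hx).div_const _).rpow_const (Or.inl (H.tailRatio_pos hβ hx).ne')

/-- The derivative is a negative constant times (h^(β+1) / F_β)^(β/(β+1)), and the quotient inside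
is nondecreasing by `rpow_mul_tail_le`. -/
theorem tailRoot_concaveOn {β : ℝ} (hβ : 0 < β) :
    ConcaveOn ℝ (Icc a b) (tailRoot a b h β) := by
  refine AntitoneOn.concaveOn_of_deriv (convex_Icc a b) (H.tailRoot_continuousOn hβ) ?_ ?_
  · rw [interior_Icc]
    exact fun x hx => (H.tailRoot_hasDerivAt hβ hx).differentiableAt.differentiableWithinAt
  rw [interior_Icc]
  intro x hx y hy hxy
  rw [(H.tailRoot_hasDerivAt hβ hx).deriv, (H.tailRoot_hasDerivAt hβ hy).deriv]
  have hFa := H.tail_pos hβ le_rfl H.lt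
  have hu := H.tailRatio_pos hβ hx
  have hv := H.tailRatio_pos hβ hy
  have hhx := (H.pos x hx).le
  have hhy := (H.pos y hy).le
  have key : h x ^ (β + 1) * (tailIntegral b h β y / tailIntegral b h β a)
      ≤ h y ^ (β + 1) * (tailIntegral b h β x / tailIntegral b h β a) := by
    rw [← mul_div_assoc, ← mul_div_assoc]
    exact div_le_div_of_nonneg_right (H.rpow_mul_tail_le hβ hx hy hxy) hFa.le
  set u := tailIntegral b h β x / tailIntegral b h β a
  set v := tailIntegral b h β y / tailIntegral b h β a
  have key2 := Real.rpow_le_rpow (by positivity) key (show 0 ≤ β / (β + 1) by positivity)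
  rw [Real.mul_rpow (by positivity) hv.le, Real.mul_rpow (by positivity) hu.le,
    ← Real.rpow_mul hhx, ← Real.rpow_mul hhy,
    show (β + 1) * (β / (β + 1)) = β by field_simp] at key2
  have e : 1 / (β + 1) - 1 = -(β / (β + 1)) := by field_simp; ring
  rw [e, Real.rpow_neg hu.le, Real.rpow_neg hv.le]
  have h1 : h x ^ β * (u ^ (β / (β + 1)))⁻¹ ≤ h y ^ β * (v ^ (β / (β + 1)))⁻¹ := by
    rw [← div_eq_mul_inv, ← div_eq_mul_inv, div_le_div_iff₀ (by positivity) (by positivity)]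
    exact key2
  have h2 := mul_le_mul_of_nonneg_left h1
    (show 0 ≤ 1 / (β + 1) / tailIntegral b h β a by positivity)
  have e3 : ∀ A B : ℝ, -A / tailIntegral b h β a * (1 / (β + 1)) * B
      = -(1 / (β + 1) / tailIntegral b h β a * (A * B)) := fun A B => by ring
  rw [e3, e3]
  exact neg_le_neg h2

/-- Monotonicity of h / (1 - φ_β): h(t) / (t - a) is nonincreasing because h is concave with h(a) ≥
0, while (1 - φ_β(t)) / (t - a) is nondecreasing because 1 - φ_β is convex and vanishes at a. -/
theorem mul_one_sub_tailRoot_le {β : ℝ} (hβ : 0 < β) {s t : ℝ} (hs : s ∈ Ioo a b)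
    (ht : t ∈ Ioo a b) (hst : s ≤ t) :
    h t * (1 - tailRoot a b h β s) ≤ h s * (1 - tailRoot a b h β t) := by
  have h1 := H.concave.chord_le le_rfl hs.1.le hst ht.2.le
  have h2 := (H.tailRoot_concaveOn hβ).chord_le le_rfl hs.1.le hst ht.2.le
  rw [H.tailRoot_left hβ] at h2
  have h3 : 0 ≤ (t - s) * h a :=
    mul_nonneg (by linarith) (H.nonneg a ⟨le_rfl, H.lt.le⟩)
  have h4 : (t - a) * (1 - tailRoot a b h β s) ≤ (s - a) * (1 - tailRoot a b h β t) := by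
    nlinarith
  have h5 := mul_le_mul_of_nonneg_left h4 (H.pos t ht).le
  have h6 := mul_le_mul_of_nonneg_right (show (s - a) * h t ≤ (t - a) * h s by linarith)
    (sub_nonneg.2 (H.tailRoot_le_one hβ (Ioo_subset_Icc_self ht)))
  refine le_of_mul_le_mul_left ?_ (sub_pos.2 ht.1)
  nlinarith

/-! ### The centroid and Jensen's inequality -/

theorem centroid_mul {α : ℝ} (hα : 0 < α) :
    functionalCentroid a b h α * (∫ t in a..b, h t ^ α) = ∫ t in a..b, t * h t ^ α :=
  div_mul_cancel₀ _ (H.integral_pos hα le_rfl H.lt le_rfl).ne'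

theorem centroid_mem {α : ℝ} (hα : 0 < α) : functionalCentroid a b h α ∈ Ioo a b := by
  have hI := H.integral_pos hα le_rfl H.lt le_rfl
  have hi1 := H.intervalIntegrable_mul (f := fun t => t) continuousOn_id hα
  have hi0 := H.intervalIntegrable_rpow hα le_rfl H.lt.le le_rfl
  constructor
  · rw [functionalCentroid, lt_div_iff₀ hI, ← sub_pos, ← intervalIntegral.integral_const_mul,
      ← intervalIntegral.integral_sub hi1 (hi0.const_mul a)]
    refine intervalIntegral.intervalIntegral_pos_of_pos_on (hi1.sub (hi0.const_mul a))
      (fun t ht => ?_) H.lt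
    rw [← sub_mul]
    exact mul_pos (sub_pos.2 ht.1) (Real.rpow_pos_of_pos (H.pos t ht) _)
  · rw [functionalCentroid, div_lt_iff₀ hI, ← sub_pos, ← intervalIntegral.integral_const_mul,
      ← intervalIntegral.integral_sub (hi0.const_mul b) hi1]
    refine intervalIntegral.intervalIntegral_pos_of_pos_on ((hi0.const_mul b).sub hi1)
      (fun t ht => ?_) H.lt
    rw [← sub_mul]
    exact mul_pos (sub_pos.2 ht.2) (Real.rpow_pos_of_pos (H.pos t ht) _)

/-- Jensen's inequality for the probability density proportional to `h ^ α`. -/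
theorem integral_mul_le_centroid {α : ℝ} (hα : 0 < α) {f : ℝ → ℝ}
    (hf : ConcaveOn ℝ (Icc a b) f) (hfc : ContinuousOn f (Icc a b))
    (hfd : ∀ x ∈ Ioo a b, DifferentiableAt ℝ f x) :
    ∫ t in a..b, f t * h t ^ α ≤ f (functionalCentroid a b h α) * ∫ t in a..b, h t ^ α := by
  have hg := H.centroid_mem hα
  have hmul := H.centroid_mul hα
  set g := functionalCentroid a b h α
  have hd := (hfd g hg).hasDerivAt
  set m := deriv f g
  have hg' := Ioo_subset_Icc_self hg
  have htan : ∀ t ∈ Icc a b, f t ≤ f g + m * (t - g) := by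
    intro t ht
    rcases lt_trichotomy t g with hlt | rfl | hlt
    · have := hf.le_slope_of_hasDerivAt ht hg' hlt hd
      rw [slope_def_field, le_div_iff₀ (by linarith)] at this
      linarith
    · simp
    · have := hf.slope_le_of_hasDerivAt hg' ht hlt hd
      rw [slope_def_field, div_le_iff₀ (by linarith)] at this
      linarith
  have hi1 := H.intervalIntegrable_mul (f := fun t => t) continuousOn_id hα
  have hi0 := H.intervalIntegrable_rpow hα le_rfl H.lt.le le_rfl
  calc ∫ t in a..b, f t * h t ^ α
      ≤ ∫ t in a..b, ((f g - m * g) * h t ^ α + m * (t * h t ^ α)) := by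
        refine intervalIntegral.integral_mono_on H.lt.le (H.intervalIntegrable_mul hfc hα)
          ((hi0.const_mul _).add (hi1.const_mul _)) fun t ht => ?_
        have := mul_le_mul_of_nonneg_right (htan t ht) (Real.rpow_nonneg (H.nonneg t ht) α)
        linarith
    _ = f g * ∫ t in a..b, h t ^ α := by
        rw [intervalIntegral.integral_add (hi0.const_mul _) (hi1.const_mul _),
          intervalIntegral.integral_const_mul, intervalIntegral.integral_const_mul, ← hmul]
        ring

/-! ### The case β ≤ α -/

/-- Up to a constant factor, the integrand is the derivative of φ_β^(β+1) (1 - φ_β)^(γ+1), which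
vanishes at both endpoints. -/
theorem integral_tailRoot_weight_eq_zero {β γ : ℝ} (hβ : 0 < β) (hγ : 0 ≤ γ) :
    ∫ t in a..b, (((β + γ + 2) * tailRoot a b h β t - (β + 1)) *
      (1 - tailRoot a b h β t) ^ γ) * h t ^ β = 0 := by
  have hFa := H.tail_pos hβ le_rfl H.lt
  have hφc := H.tailRoot_continuousOn hβ
  have hint := H.intervalIntegrable_mul (f := fun t => ((β + γ + 2) * tailRoot a b h β t - (β + 1))
      * (1 - tailRoot a b h β t) ^ γ)
    (((hφc.const_mul _).sub continuousOn_const).mul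
      ((continuousOn_const.sub hφc).rpow_const fun _ _ => Or.inr hγ)) hβ
  have key := intervalIntegral.integral_eq_sub_of_hasDerivAt_of_le H.lt.le
    (f := fun t => (β + 1) * tailIntegral b h β a * (tailIntegral b h β t / tailIntegral b h β a *
      (1 - tailRoot a b h β t) ^ (γ + 1)))
    (f' := fun t => (((β + γ + 2) * tailRoot a b h β t - (β + 1)) *
      (1 - tailRoot a b h β t) ^ γ) * h t ^ β) ?_ ?_ hint
  · rw [key, H.tailRoot_left hβ, tailIntegral_right, sub_self, Real.zero_rpow (by positivity)]
    simp
  · exact (((H.tail_continuousOn hβ).div_const _).mul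
      ((continuousOn_const.sub hφc).rpow_const fun _ _ => Or.inr (by positivity))).const_mul _
  · intro t ht
    have h1 := (H.tail_hasDerivAt hβ ht).div_const (tailIntegral b h β a)
    have h2 := ((H.tailRoot_hasDerivAt hβ ht).const_sub 1).rpow_const (p := γ + 1)
      (Or.inr (by linarith))
    have hu := H.tailRatio_pos hβ ht
    have h1φ : 0 < 1 - tailRoot a b h β t := by
      rw [sub_pos, ← H.tailRoot_left hβ]
      exact H.tailRoot_strictAntiOn hβ ⟨le_rfl, H.lt.le⟩ (Ioo_subset_Icc_self ht) ht.1
    refine ((h1.fun_mul h2).const_mul ((β + 1) * tailIntegral b h β a)).congr_deriv ?_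
    have hφ : tailRoot a b h β t
        = tailIntegral b h β t / tailIntegral b h β a *
          (tailIntegral b h β t / tailIntegral b h β a) ^ (1 / (β + 1) - 1) := by
      rw [tailRoot, Real.rpow_sub_one hu.ne']
      generalize tailIntegral b h β t / tailIntegral b h β a = u at hu
      field_simp
    rw [add_sub_cancel_right, Real.rpow_add_one h1φ.ne']
    generalize hK : (1 - tailRoot a b h β t) ^ γ = K
    have hp : β + 1 ≠ 0 := by positivity
    generalize hW : (tailIntegral b h β t / tailIntegral b h β a) ^ (1 / (β + 1) - 1) = W at hφ ⊢
    generalize tailIntegral b h β t / tailIntegral b h β a = u at hφ ⊢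
    rw [hφ]
    field_simp
    ring

/-- In the zero-integral identity with γ = α - β, replacing a multiple of (1 - φ_β)^γ by h^γ can
only raise the integral: h is larger where the factor (α+2) φ_β - (β+1) is nonnegative and smaller
where it is nonpositive. -/
theorem le_integral_tailRoot_mul {α β : ℝ} (hβ : 0 < β) (hβα : β ≤ α) :
    (β + 1) * ∫ t in a..b, h t ^ α ≤ (α + 2) * ∫ t in a..b, tailRoot a b h β t * h t ^ α := by
  have hα : 0 < α := hβ.trans_le hβα
  have hγ : 0 ≤ α - β := by linarith
  have hzero := H.integral_tailRoot_weight_eq_zero hβ hγ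
  rw [show β + (α - β) + 2 = α + 2 by ring] at hzero
  have hφc := H.tailRoot_continuousOn hβ
  obtain ⟨s, hs, hφs⟩ : ∃ s ∈ Ioo a b, tailRoot a b h β s = (β + 1) / (α + 2) := by
    have hlt1 : (β + 1) / (α + 2) < 1 := by rw [div_lt_one (by linarith)]; linarith
    have hpos : 0 < (β + 1) / (α + 2) := by positivity
    obtain ⟨s, hs, hφs⟩ := intermediate_value_Ioo' H.lt.le hφc
      (show (β + 1) / (α + 2) ∈ Ioo _ _ by
        rw [H.tailRoot_left hβ, tailRoot_right a b h hβ]; exact ⟨hpos, hlt1⟩)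
    exact ⟨s, hs, hφs⟩
  have hlt : ∀ t ∈ Ioo a b, 0 < 1 - tailRoot a b h β t := fun t ht => by
    rw [sub_pos, ← H.tailRoot_left hβ]
    exact H.tailRoot_strictAntiOn hβ ⟨le_rfl, H.lt.le⟩ (Ioo_subset_Icc_self ht) ht.1
  have hs1 := hlt s hs
  have hαs : (α + 2) * tailRoot a b h β s = β + 1 := by rw [hφs]; field_simp
  -- The scale w makes w (1 - φ_β) meet h at s, the point where the linear factor changes sign.
  set w := h s / (1 - tailRoot a b h β s) with hw
  have hw0 : 0 < w := div_pos (H.pos s hs) hs1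
  have hint := H.intervalIntegrable_mul (f := fun t => ((α + 2) * tailRoot a b h β t - (β + 1))
      * (1 - tailRoot a b h β t) ^ (α - β))
    (((hφc.const_mul _).sub continuousOn_const).mul
      ((continuousOn_const.sub hφc).rpow_const fun _ _ => Or.inr hγ)) hβ
  have hint2 := H.intervalIntegrable_mul (f := fun t => (α + 2) * tailRoot a b h β t - (β + 1))
    ((hφc.const_mul _).sub continuousOn_const) hα
  have hmono := intervalIntegral.integral_mono_on_of_le_Ioo H.lt.le (hint.const_mul (w ^ (α - β)))
    hint2 fun t ht => by
      have hht := H.pos t ht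
      have h1t := hlt t ht
      have e : h t ^ α = h t ^ (α - β) * h t ^ β := by
        rw [← Real.rpow_add hht]; congr 1; ring
      have e2 : w ^ (α - β) * (1 - tailRoot a b h β t) ^ (α - β)
          = (w * (1 - tailRoot a b h β t)) ^ (α - β) := (Real.mul_rpow hw0.le h1t.le).symm
      have e3 : w ^ (α - β) * (((α + 2) * tailRoot a b h β t - (β + 1)) *
          (1 - tailRoot a b h β t) ^ (α - β) * h t ^ β)
          = (((α + 2) * tailRoot a b h β t - (β + 1)) *
            (w * (1 - tailRoot a b h β t)) ^ (α - β)) * h t ^ β := by rw [← e2]; ring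
      rw [e3, e, ← mul_assoc]
      refine mul_le_mul_of_nonneg_right ?_ (Real.rpow_nonneg hht.le _)
      rcases le_total t s with hts | hst
      · have hle : w * (1 - tailRoot a b h β t) ≤ h t := by
          rw [hw, div_mul_eq_mul_div, div_le_iff₀ hs1]
          exact H.mul_one_sub_tailRoot_le hβ ht hs hts
        have hφ := (H.tailRoot_strictAntiOn hβ).antitoneOn (Ioo_subset_Icc_self ht)
          (Ioo_subset_Icc_self hs) hts
        exact mul_le_mul_of_nonneg_left (Real.rpow_le_rpow (by positivity) hle hγ) (by nlinarith)
      · have hle : h t ≤ w * (1 - tailRoot a b h β t) := by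
          rw [hw, div_mul_eq_mul_div, le_div_iff₀ hs1]
          exact H.mul_one_sub_tailRoot_le hβ hs ht hst
        have hφ := (H.tailRoot_strictAntiOn hβ).antitoneOn (Ioo_subset_Icc_self hs)
          (Ioo_subset_Icc_self ht) hst
        exact mul_le_mul_of_nonpos_left (Real.rpow_le_rpow hht.le hle hγ) (by nlinarith)
  rw [intervalIntegral.integral_const_mul, hzero, mul_zero] at hmono
  have e : ∫ t in a..b, ((α + 2) * tailRoot a b h β t - (β + 1)) * h t ^ α
      = (α + 2) * (∫ t in a..b, tailRoot a b h β t * h t ^ α)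
        - (β + 1) * ∫ t in a..b, h t ^ α := by
    rw [← intervalIntegral.integral_const_mul, ← intervalIntegral.integral_const_mul,
      ← intervalIntegral.integral_sub ((H.intervalIntegrable_mul hφc hα).const_mul _)
        ((H.intervalIntegrable_rpow hα le_rfl H.lt.le le_rfl).const_mul _)]
    congr 1; ext t; ring
  linarith

theorem le_tailRoot_centroid {α β : ℝ} (hβ : 0 < β) (hβα : β ≤ α) :
    (β + 1) / (α + 2) ≤ tailRoot a b h β (functionalCentroid a b h α) := by
  have hα : 0 < α := hβ.trans_le hβα
  have h1 := H.le_integral_tailRoot_mul hβ hβα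
  have h2 := H.integral_mul_le_centroid hα (H.tailRoot_concaveOn hβ) (H.tailRoot_continuousOn hβ)
    fun x hx => (H.tailRoot_hasDerivAt hβ hx).differentiableAt
  have hI := H.integral_pos hα le_rfl H.lt le_rfl
  rw [div_le_iff₀ (by positivity)]
  refine le_of_mul_le_mul_right ?_ hI
  have h3 := mul_le_mul_of_nonneg_left h2 (show 0 ≤ α + 2 by positivity)
  linarith

end IsPosConcave

/-! ### The case α ≤ β -/

/-- The function z^β - (β/α) s^(β-α) z^α decreases on [0, s] and increases on [s, ∞), and y lies
beyond k on the same side of s. This transfers a single-crossing comparison from exponent α to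
exponent β. -/
theorem rpow_sub_le_of_between {α β s y k : ℝ} (hα : 0 < α) (hαβ : α ≤ β) (hs : 0 ≤ s)
    (hy : 0 ≤ y) (hk : 0 ≤ k) (hor : (k ≤ y ∧ s ≤ k) ∨ (y ≤ k ∧ k ≤ s)) :
    β / α * s ^ (β - α) * (y ^ α - k ^ α) ≤ y ^ β - k ^ β := by
  have hβ : 0 < β := hα.trans_le hαβ
  have hq : 0 ≤ β - α := by linarith
  have hcont : Continuous fun z : ℝ => z ^ β - β / α * s ^ (β - α) * z ^ α :=
    (Real.continuous_rpow_const hβ.le).sub ((Real.continuous_rpow_const hα.le).const_mul _)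
  have hder : ∀ z : ℝ, 0 < z → HasDerivAt (fun z : ℝ => z ^ β - β / α * s ^ (β - α) * z ^ α)
      (β * z ^ (α - 1) * (z ^ (β - α) - s ^ (β - α))) z := by
    intro z hz
    refine ((Real.hasDerivAt_rpow_const (Or.inl hz.ne')).sub
      ((Real.hasDerivAt_rpow_const (p := α) (Or.inl hz.ne')).const_mul _)).congr_deriv ?_
    have : z ^ (β - 1) = z ^ (α - 1) * z ^ (β - α) := by
      rw [← Real.rpow_add hz]; congr 1; ring
    rw [this]
    field_simp
  suffices k ^ β - β / α * s ^ (β - α) * k ^ α ≤ y ^ β - β / α * s ^ (β - α) * y ^ α by linarith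
  rcases hor with ⟨hky, hsk⟩ | ⟨hyk, hks⟩
  · have hm : MonotoneOn (fun z : ℝ => z ^ β - β / α * s ^ (β - α) * z ^ α) (Ici s) := by
      refine monotoneOn_of_deriv_nonneg (convex_Ici s) hcont.continuousOn ?_ ?_ <;>
        rw [interior_Ici]
      · exact fun z hz => (hder z (hs.trans_lt hz)).differentiableAt.differentiableWithinAt
      · intro z hz
        have hz0 : 0 < z := hs.trans_lt hz
        rw [(hder z hz0).deriv]
        exact mul_nonneg (by positivity) (sub_nonneg.2 (Real.rpow_le_rpow hs (le_of_lt hz) hq))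
    exact hm hsk (hsk.trans hky) hky
  · have hm : AntitoneOn (fun z : ℝ => z ^ β - β / α * s ^ (β - α) * z ^ α) (Icc 0 s) := by
      refine antitoneOn_of_deriv_nonpos (convex_Icc 0 s) hcont.continuousOn ?_ ?_ <;>
        rw [interior_Icc]
      · exact fun z hz => (hder z hz.1).differentiableAt.differentiableWithinAt
      · intro z hz
        rw [(hder z hz.1).deriv]
        have := hz.1
        exact mul_nonpos_of_nonneg_of_nonpos (by positivity)
          (sub_nonpos.2 (Real.rpow_le_rpow hz.1.le hz.2.le hq))
    exact hm ⟨hy, hyk.trans hks⟩ ⟨hk, hks⟩ hyk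

namespace IsPosConcave

variable {a b : ℝ} {h : ℝ → ℝ} (H : IsPosConcave a b h)
include H

/-- For concave `h`, the quotient `(β + 1) * (∫_x^b h ^ β) / h x ^ (β + 1)` is nondecreasing
in `β`. -/
theorem tail_mul_rpow_le {α β : ℝ} (hα : 0 < α) (hαβ : α ≤ β) {x : ℝ} (hx : x ∈ Ioo a b) :
    h x ^ (β + 1) * ((α + 1) * tailIntegral b h α x)
      ≤ h x ^ (α + 1) * ((β + 1) * tailIntegral b h β x) := by
  have hβ : 0 < β := hα.trans_le hαβ
  have hhx := H.pos x hx
  have hF := H.tail_pos hα hx.1.le hx.2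
  -- The line of slope -m from (x, h x), followed down to its zero, has the same α-power integral as
  -- h on [x, b].
  obtain ⟨m, hm⟩ : ∃ m, m = h x ^ (α + 1) / ((α + 1) * tailIntegral b h α x) := ⟨_, rfl⟩
  have hm0 : 0 < m := by rw [hm]; positivity
  have hmF : m * ((α + 1) * tailIntegral b h α x) = h x ^ (α + 1) := by
    rw [hm]; field_simp
  have hbx : 0 < b - x := sub_pos.2 hx.2
  have hci : ∀ c : ℝ, 0 < c → ∀ d : ℝ,
      IntervalIntegrable (fun t => (h x - d * (t - x)) ^ c) volume x b :=
    fun c hc d => (Continuous.rpow_const (by fun_prop) fun _ => Or.inr hc.le).intervalIntegrable _ _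
  -- The line reaches zero no earlier than b, because the segment from (x, h x) to (b, 0) lies below
  -- h.
  have hmb : m * (b - x) ≤ h x := by
    have hd : 0 < h x / (b - x) := by positivity
    have e : h x / (b - x) * (b - x) = h x := by field_simp
    have h1 : ∫ t in x..b, (h x - h x / (b - x) * (t - x)) ^ α ≤ tailIntegral b h α x := by
      refine intervalIntegral.integral_mono_on hx.2.le (hci α hα _)
        (H.intervalIntegrable_rpow hα hx.1.le hx.2.le le_rfl) fun t ht => ?_
      have e1 : h x - h x / (b - x) * (t - x) = h x * (b - t) / (b - x) := by field_simp; ring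
      rw [e1]
      refine Real.rpow_le_rpow
        (div_nonneg (mul_nonneg hhx.le (sub_nonneg.2 ht.2)) hbx.le) ?_ hα.le
      rw [div_le_iff₀ hbx]
      have := H.concave.chord_le hx.1.le ht.1 ht.2 le_rfl
      have hb : 0 ≤ (t - x) * h b :=
        mul_nonneg (sub_nonneg.2 ht.1) (H.nonneg b ⟨H.lt.le, le_rfl⟩)
      linarith
    rw [integral_line_rpow hα hd, e, sub_self, Real.zero_rpow (by positivity), sub_zero,
      div_le_iff₀ (by positivity)] at h1
    have h2 : m * ((α + 1) * tailIntegral b h α x)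
        ≤ h x / (b - x) * ((α + 1) * tailIntegral b h α x) := by
      rw [hmF]; linarith
    have h3 := le_of_mul_le_mul_right h2 (by positivity)
    rwa [le_div_iff₀ hbx] at h3
  set k : ℝ → ℝ := fun t => h x - m * (t - x) with hk
  have hkanti : ∀ s t, s ≤ t → k t ≤ k s := fun s t hst => by
    simp only [hk]; nlinarith
  have hkb : 0 ≤ k b := by simp only [hk]; linarith
  have hk0 : ∀ t, t ≤ b → 0 ≤ k t := fun t ht => hkb.trans (hkanti t b ht)
  -- Since h - k is concave and vanishes at x, it is nonnegative before the last point where k ≤ h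
  -- and negative after it; s is the supremum of such points.
  obtain ⟨s, hs, hcross⟩ : ∃ s ∈ Icc x b, ∀ t ∈ Icc x b,
      (k t ≤ h t ∧ k s ≤ k t) ∨ (h t ≤ k t ∧ k t ≤ k s) := by
    let S : Set ℝ := {t | t ∈ Icc x b ∧ k t ≤ h t}
    have hxS : x ∈ S := ⟨⟨le_rfl, hx.2.le⟩, by simp [hk]⟩
    have hbdd : BddAbove S := ⟨b, fun t ht => ht.1.2⟩
    have hsup : sSup S ∈ Icc x b := ⟨le_csSup hbdd hxS, csSup_le ⟨x, hxS⟩ fun t ht => ht.1.2⟩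
    refine ⟨sSup S, hsup, fun t ht => ?_⟩
    rcases lt_trichotomy t (sSup S) with hlt | heq | hgt
    · obtain ⟨u, hu, htu⟩ := exists_lt_of_lt_csSup ⟨x, hxS⟩ hlt
      refine Or.inl ⟨?_, hkanti _ _ hlt.le⟩
      have h1 := H.concave.chord_le hx.1.le ht.1 htu.le hu.1.2
      have hxu : 0 < u - x := by linarith [ht.1]
      have h2 := mul_le_mul_of_nonneg_left hu.2 (sub_nonneg.2 ht.1)
      refine le_of_mul_le_mul_left ?_ hxu
      have h3 : (u - x) * k t = (u - t) * h x + (t - x) * k u := by simp only [hk]; ring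
      linarith
    · rw [← heq]
      rcases le_total (k t) (h t) with hle | hle
      · exact Or.inl ⟨hle, le_rfl⟩
      · exact Or.inr ⟨hle, le_rfl⟩
    · refine Or.inr ⟨?_, hkanti _ _ hgt.le⟩
      by_contra! hcon
      exact absurd (le_csSup hbdd (show t ∈ S from ⟨ht, hcon.le⟩)) (not_le.2 hgt)
  have hiα := H.intervalIntegrable_rpow hα hx.1.le hx.2.le le_rfl
  have hiβ := H.intervalIntegrable_rpow hβ hx.1.le hx.2.le le_rfl
  have hmono := intervalIntegral.integral_mono_on hx.2.le
    (((hiα.sub (hci α hα m)).const_mul (β / α * k s ^ (β - α)))) (hiβ.sub (hci β hβ m))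
    fun t ht => rpow_sub_le_of_between hα hαβ (hk0 s hs.2)
      (H.nonneg t ⟨hx.1.le.trans ht.1, ht.2⟩) (hk0 t ht.2) (hcross t ht)
  rw [intervalIntegral.integral_const_mul, intervalIntegral.integral_sub hiα (hci α hα m),
    intervalIntegral.integral_sub hiβ (hci β hβ m), integral_line_rpow hα hm0,
    integral_line_rpow hβ hm0] at hmono
  change β / α * k s ^ (β - α) * (tailIntegral b h α x -
    (h x ^ (α + 1) - k b ^ (α + 1)) / ((α + 1) * m)) ≤ tailIntegral b h β x -
    (h x ^ (β + 1) - k b ^ (β + 1)) / ((β + 1) * m) at hmono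
  -- By the choice of m, the α-excess of h over the line on [x, b] is the part of the line's
  -- integral past b.
  have e1 : tailIntegral b h α x - (h x ^ (α + 1) - k b ^ (α + 1)) / ((α + 1) * m)
      = k b ^ (α + 1) / ((α + 1) * m) := by
    rw [← hmF]; field_simp; ring
  rw [e1] at hmono
  -- The β-integral of the line past b is absorbed by the α-excess, using k b ≤ k s and α(α+1) ≤
  -- β(β+1).
  have h1 : k b ^ (β + 1) / ((β + 1) * m)
      ≤ β / α * k s ^ (β - α) * (k b ^ (α + 1) / ((α + 1) * m)) := by
    have h2 : k b ^ (β + 1) ≤ k s ^ (β - α) * k b ^ (α + 1) := by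
      have : k b ^ (β + 1) = k b ^ (β - α) * k b ^ (α + 1) := by
        rw [← Real.rpow_add_of_nonneg hkb (by linarith) (by linarith)]; congr 1; ring
      rw [this]
      exact mul_le_mul_of_nonneg_right
        (Real.rpow_le_rpow hkb (hkanti s b hs.2) (by linarith)) (Real.rpow_nonneg hkb _)
    have h3 : 1 / (β + 1) ≤ β / (α * (α + 1)) := by
      rw [div_le_div_iff₀ (by positivity) (by positivity)]; nlinarith
    calc k b ^ (β + 1) / ((β + 1) * m) = 1 / (β + 1) * (k b ^ (β + 1) / m) := by field_simp
      _ ≤ β / (α * (α + 1)) * ((k s ^ (β - α) * k b ^ (α + 1)) / m) := by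
        refine mul_le_mul h3 (div_le_div_of_nonneg_right h2 hm0.le)
          (div_nonneg (Real.rpow_nonneg hkb _) hm0.le) (by positivity)
      _ = _ := by field_simp
  have h4 : h x ^ (β + 1) / ((β + 1) * m) ≤ tailIntegral b h β x := by
    rw [sub_div] at hmono; linarith
  rw [div_le_iff₀ (by positivity)] at h4
  rw [← hmF]
  have := mul_le_mul_of_nonneg_right h4 (show 0 ≤ (α + 1) * tailIntegral b h α x by positivity)
  linarith

/-- By `tail_mul_rpow_le`, log φ_β - log φ_α has nonnegative derivative, and it is zero at a. -/
theorem tailRoot_mono {α β : ℝ} (hα : 0 < α) (hαβ : α ≤ β) {x : ℝ} (hx : x ∈ Ioo a b) :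
    tailRoot a b h α x ≤ tailRoot a b h β x := by
  have hβ : 0 < β := hα.trans_le hαβ
  -- The endpoint b is excluded because the tail vanishes there; a is kept because the comparison
  -- starts from it.
  have hcont : ∀ γ : ℝ, 0 < γ → ContinuousOn (fun t => Real.log (tailIntegral b h γ t) / (γ + 1))
      (Ico a b) := fun γ hγ =>
    (((H.tail_continuousOn hγ).mono Ico_subset_Icc_self).log fun t ht =>
      (H.tail_pos hγ ht.1 ht.2).ne').div_const _
  have hder : ∀ t ∈ Ioo a b, HasDerivAt (fun t => Real.log (tailIntegral b h β t) / (β + 1)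
      - Real.log (tailIntegral b h α t) / (α + 1))
      (-h t ^ β / tailIntegral b h β t / (β + 1) - -h t ^ α / tailIntegral b h α t / (α + 1)) t :=
    fun t ht =>
      (((H.tail_hasDerivAt hβ ht).log (H.tail_pos hβ ht.1.le ht.2).ne').div_const _).sub
      (((H.tail_hasDerivAt hα ht).log (H.tail_pos hα ht.1.le ht.2).ne').div_const _)
  have hmono : MonotoneOn (fun t => Real.log (tailIntegral b h β t) / (β + 1)
      - Real.log (tailIntegral b h α t) / (α + 1)) (Ico a b) := by
    refine monotoneOn_of_deriv_nonneg (convex_Ico a b) ((hcont β hβ).sub (hcont α hα)) ?_ ?_ <;>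
      rw [interior_Ico]
    · exact fun t ht => (hder t ht).differentiableAt.differentiableWithinAt
    · intro t ht
      rw [(hder t ht).deriv]
      have hht := H.pos t ht
      have hFα := H.tail_pos hα ht.1.le ht.2
      have hFβ := H.tail_pos hβ ht.1.le ht.2
      have key := H.tail_mul_rpow_le hα hαβ ht
      rw [Real.rpow_add_one hht.ne', Real.rpow_add_one hht.ne'] at key
      have h1 : h t ^ β * ((α + 1) * tailIntegral b h α t)
          ≤ h t ^ α * ((β + 1) * tailIntegral b h β t) := by
        refine le_of_mul_le_mul_right ?_ hht
        linarith
      have h2 : h t ^ β / ((β + 1) * tailIntegral b h β t)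
          ≤ h t ^ α / ((α + 1) * tailIntegral b h α t) := by
        rwa [div_le_div_iff₀ (by positivity) (by positivity)]
      have e : -h t ^ β / tailIntegral b h β t / (β + 1) - -h t ^ α / tailIntegral b h α t / (α + 1)
          = h t ^ α / ((α + 1) * tailIntegral b h α t)
            - h t ^ β / ((β + 1) * tailIntegral b h β t) := by
        field_simp; ring
      rw [e]; linarith
  have hx' := hmono ⟨le_rfl, H.lt⟩ ⟨hx.1.le, hx.2⟩ hx.1.le
  have hlog : ∀ γ : ℝ, 0 < γ → Real.log (tailRoot a b h γ x)
      = Real.log (tailIntegral b h γ x) / (γ + 1) - Real.log (tailIntegral b h γ a) / (γ + 1) :=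
    fun γ hγ => by
      rw [tailRoot, Real.log_rpow (H.tailRatio_pos hγ hx),
        Real.log_div (H.tail_pos hγ hx.1.le hx.2).ne' (H.tail_pos hγ le_rfl H.lt).ne']
      ring
  refine (Real.log_le_log_iff (Real.rpow_pos_of_pos (H.tailRatio_pos hα hx) _)
    (Real.rpow_pos_of_pos (H.tailRatio_pos hβ hx) _)).1 ?_
  change Real.log (tailRoot a b h α x) ≤ Real.log (tailRoot a b h β x)
  rw [hlog α hα, hlog β hβ]
  simp only at hx'
  linarith

end IsPosConcave

theorem theoremt (a b : ℝ) (hab : a < b) (h : ℝ → ℝ)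
    (h_nonneg : ∀ t ∈ Set.Icc a b, 0 ≤ h t)
    (h_concave : ConcaveOn ℝ (Set.Icc a b) h)
    (h_integral_pos : 0 < ∫ t in a..b, h t)
    (α β : ℝ) (hα : 0 < α) (hβ : 0 < β) :
    (β ≤ α →
      ((β + 1) / (α + 2)) ^ (β + 1) ≤
        (∫ t in (functionalCentroid a b h α)..b, h t ^ β) / (∫ t in a..b, h t ^ β)) ∧
    (α ≤ β →
      ((α + 1) / (α + 2)) ^ (β + 1) ≤
        (∫ t in (functionalCentroid a b h α)..b, h t ^ β) / (∫ t in a..b, h t ^ β)) := by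
  have H := IsPosConcave.of_integral_pos hab h_nonneg h_concave h_integral_pos
  have hg := H.centroid_mem hα
  have hroot := H.tailRoot_rpow hβ (Set.Ioo_subset_Icc_self hg)
  rw [tailIntegral, tailIntegral] at hroot
  rw [← hroot]
  refine ⟨fun hle => ?_, fun hle => ?_⟩
  · exact Real.rpow_le_rpow (by positivity) (H.le_tailRoot_centroid hβ hle) (by positivity)
  · exact Real.rpow_le_rpow (by positivity)
      ((H.le_tailRoot_centroid hα le_rfl).trans (H.tailRoot_mono hα hle hg)) (by positivity)
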